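/- Let $M\subset\mathbb{C}^d$ be a bounded, connected, embedded complex submanifold, and put $\partial M:=\overline{M}\setminus M$, with the closure taken in $\mathbb{C}^d$. Let $\mathsf{k}_M$ be the Kobayashi distance and $\kappa_M$ the Kobayashi--Royden metric of $M$ (normalized so that $\kappa_{\mathbb{D}}(z;v)=|v|/(1-|z|^2)$ and $\mathsf{k}_{\mathbb{D}}(0,z)=\tanh^{-1}|z|$ on the unit disc $\mathbb{D}$). For $\kappa>0$, a $(1,\kappa)$-almost-geodesic is an absolutely continuous curve $\sigma:[a,b]\to M$ such that $$|t-s|-\kappa\le \mathsf{k}_M(\sigma(t),\sigma(s))\le |t-s|+\kappa\quad\text{for all } s,t\in[a,b],$$ and $\kappa_M(\sigma(t);\sigma'(t))\le 1$ for almost every $t\in[a,b]$. Say that $M$ has the visibility property with respect to $(1,\kappa)$-almost-geodesics if (i) any two distinct points of $M$ can be joined by a $(1,\kappa)$-almost-geodesic, and (ii) for every pair of points $p\neq q$ in $\partial M$ there exist neighbourhoods $V$ of $p$ and $W$ of $q$ in $\mathbb{C}^d$ with $\overline V\cap\overline W=\emptyset$, and a compact set $K\subset M$, such that every $(1,\kappa)$-almost-geodesic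 in $M$ with initial point in $V$ and terminal point in $W$ intersects $K$. Theorem. Suppose that there exists $\kappa_0>0$ such that $M$ has the visibility property with respect to $(1,\kappa_0)$-almost-geodesics. Let $F:M\to M$ be a holomorphic map such that the sequence of iterates $(F^{\nu})_{\nu\ge1}$ converges, uniformly on compact subsets of $M$, to a holomorphic map $\psi:M\to\mathbb{C}^d$ with $\psi(M)\subset\partial M$. Then $\psi$ is constant. -/

import Mathlib

open Set Filter Topology MeasureTheory
open scoped ENNReal ComplexConjugate

namespace KobVis

noncomputable section

/-- `M` is an embedded complex submanifold of `ℂ^d` of complex dimension `n` (not necessarily a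
closed subset): around each of its points there are holomorphic coordinates of `ℂ^d` in which `M`
is an `n`-dimensional complex linear subspace. -/
def IsEmbeddedComplexSubmanifold {d : ℕ} (n : ℕ) (M : Set (EuclideanSpace ℂ (Fin d))) : Prop :=
  ∀ p ∈ M, ∃ (e : OpenPartialHomeomorph (EuclideanSpace ℂ (Fin d)) (EuclideanSpace ℂ (Fin d)))
    (L : Submodule ℂ (EuclideanSpace ℂ (Fin d))),
    Module.finrank ℂ L = n ∧ p ∈ e.source ∧
      DifferentiableOn ℂ e e.source ∧ DifferentiableOn ℂ e.symm e.target ∧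
      ∀ x ∈ e.source, x ∈ M ↔ e x ∈ L

/-- The boundary `∂M = closure M \ M`. -/
def bdry {d : ℕ} (M : Set (EuclideanSpace ℂ (Fin d))) : Set (EuclideanSpace ℂ (Fin d)) :=
  closure M \ M

/-- `f` is holomorphic on the submanifold `M`: near each point of `M` it is the restriction to `M`
of a holomorphic map defined on an open subset of `ℂ^d`. The values of `f` off `M` are
irrelevant. -/
def HolomorphicOnSubmanifold {d m : ℕ} (M : Set (EuclideanSpace ℂ (Fin d)))
    (f : EuclideanSpace ℂ (Fin d) → EuclideanSpace ℂ (Fin m)) : Prop :=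
  ∀ p ∈ M, ∃ (U : Set (EuclideanSpace ℂ (Fin d)))
    (g : EuclideanSpace ℂ (Fin d) → EuclideanSpace ℂ (Fin m)),
    IsOpen U ∧ p ∈ U ∧ DifferentiableOn ℂ g U ∧ EqOn f g (U ∩ M)

/-- `φ` restricts to a holomorphic map from the open unit disc to `M`. -/
def IsHolomorphicDisc {d : ℕ} (M : Set (EuclideanSpace ℂ (Fin d)))
    (φ : ℂ → EuclideanSpace ℂ (Fin d)) : Prop :=
  DifferentiableOn ℂ φ (Metric.ball 0 1) ∧ MapsTo φ (Metric.ball 0 1) M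

/-- The Poincaré distance of the open unit disc, `tanh⁻¹ |(a - b) / (1 - conj a * b)|`, that is,
the distance of the metric `|dz| / (1 - |z|²)`. -/
def poincareDist (a b : ℂ) : ℝ :=
  Real.artanh ‖(a - b) / (1 - conj a * b)‖

/-- `ℓ` is the length of a chain of `N` holomorphic discs in `M` from `p` to `q`: the `i`-th disc
`φ i` joins `z i = φ i (a i)` to `z (i + 1) = φ i (b i)`. -/
def IsChainLength {d : ℕ} (M : Set (EuclideanSpace ℂ (Fin d))) (p q : EuclideanSpace ℂ (Fin d))
    (ℓ : ℝ) : Prop :=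
  ∃ (N : ℕ) (z : ℕ → EuclideanSpace ℂ (Fin d)) (φ : ℕ → ℂ → EuclideanSpace ℂ (Fin d))
    (a b : ℕ → ℂ),
    z 0 = p ∧ z N = q ∧
    (∀ i < N, IsHolomorphicDisc M (φ i) ∧ a i ∈ Metric.ball (0 : ℂ) 1 ∧
      b i ∈ Metric.ball (0 : ℂ) 1 ∧ φ i (a i) = z i ∧ φ i (b i) = z (i + 1)) ∧
    ℓ = ∑ i ∈ Finset.range N, poincareDist (a i) (b i)

/-- The Kobayashi (pseudo)distance of `M`: the infimum of the lengths of chains of holomorphic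
discs (`⊤` when there is no chain, which does not happen on a connected `M`). -/
def kobayashiDist {d : ℕ} (M : Set (EuclideanSpace ℂ (Fin d)))
    (p q : EuclideanSpace ℂ (Fin d)) : ℝ≥0∞ :=
  ⨅ (ℓ : ℝ) (_ : IsChainLength M p q ℓ), ENNReal.ofReal ℓ

/-- The Kobayashi–Royden (pseudo)metric of `M`: the infimum of `|ξ|` over all holomorphic discs
`φ` in `M` with `φ 0 = p` and `φ'(0) ξ = v` (`⊤` when there is none, which does not happen for `v`
tangent to `M` at `p`). -/
def kobayashiMetric {d : ℕ} (M : Set (EuclideanSpace ℂ (Fin d)))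
    (p v : EuclideanSpace ℂ (Fin d)) : ℝ≥0∞ :=
  ⨅ (φ : ℂ → EuclideanSpace ℂ (Fin d)) (ξ : ℂ)
    (_ : IsHolomorphicDisc M φ ∧ φ 0 = p ∧ ξ • deriv φ 0 = v), ENNReal.ofReal ‖ξ‖

/-- The curve `σ : [a, b] → M` is a `(lam, κ)`-almost-geodesic of `M`. The values of `σ` off
`[a, b]` are irrelevant. -/
structure IsAlmostGeodesic {d : ℕ} (M : Set (EuclideanSpace ℂ (Fin d))) (lam κ a b : ℝ)
    (σ : ℝ → EuclideanSpace ℂ (Fin d)) : Prop where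
  le : a ≤ b
  mapsTo : MapsTo σ (Icc a b) M
  lower : ∀ s ∈ Icc a b, ∀ t ∈ Icc a b,
    ENNReal.ofReal (1 / lam * |t - s| - κ) ≤ kobayashiDist M (σ t) (σ s)
  upper : ∀ s ∈ Icc a b, ∀ t ∈ Icc a b,
    kobayashiDist M (σ t) (σ s) ≤ ENNReal.ofReal (lam * |t - s| + κ)
  absCont : AbsolutelyContinuousOnInterval σ a b
  speed : ∀ᵐ t ∂(volume.restrict (Icc a b)),
    DifferentiableAt ℝ σ t ∧ kobayashiMetric M (σ t) (deriv σ t) ≤ ENNReal.ofReal lam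

/-- `M` has the visibility property with respect to `(lam, κ)`-almost-geodesics. -/
structure HasVisibility {d : ℕ} (M : Set (EuclideanSpace ℂ (Fin d))) (lam κ : ℝ) : Prop where
  joined : ∀ p ∈ M, ∀ q ∈ M, p ≠ q →
    ∃ (a b : ℝ) (σ : ℝ → EuclideanSpace ℂ (Fin d)),
      IsAlmostGeodesic M lam κ a b σ ∧ σ a = p ∧ σ b = q
  visible : ∀ p ∈ bdry M, ∀ q ∈ bdry M, p ≠ q →
    ∃ V ∈ 𝓝 p, ∃ W ∈ 𝓝 q, ∃ K : Set (EuclideanSpace ℂ (Fin d)),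
      IsCompact K ∧ K ⊆ M ∧ closure V ∩ closure W = ∅ ∧
      ∀ (a b : ℝ) (σ : ℝ → EuclideanSpace ℂ (Fin d)), IsAlmostGeodesic M lam κ a b σ →
        σ a ∈ V → σ b ∈ W → (σ '' Icc a b ∩ K).Nonempty

end

end KobVis

namespace KobVis

section

variable {d m : ℕ} {M : Set (EuclideanSpace ℂ (Fin d))}

/-! The additive constant `κ₀` makes every sufficiently short radial piece of a holomorphic disc an
almost-geodesic: its Kobayashi diameter is below `κ₀`, and Kobayashi–Royden speed at most 1 comes
from discs (`IsHolomorphicDisc.isAlmostGeodesic`). The admissible length does not depend on the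
disc, so for a fixed disc `φ` all the segments of `F^[ν] ∘ φ` qualify at once. They converge
uniformly to a curve in `bdry M`. If its endpoints differed, visibility would make the segments with
large `ν` meet a fixed compact subset of `M`, which is impossible
(`HasVisibility.eq_of_isHolomorphicDisc`). Nearby points of `M` lie on such segments, so `ψ` is
locally constant, hence constant by connectedness. -/

theorem HolomorphicOnSubmanifold.differentiableOn_comp
    {f : EuclideanSpace ℂ (Fin d) → EuclideanSpace ℂ (Fin m)} {φ : ℂ → EuclideanSpace ℂ (Fin d)}
    (hf : HolomorphicOnSubmanifold M f) (hφ : IsHolomorphicDisc M φ) :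
    DifferentiableOn ℂ (f ∘ φ) (Metric.ball 0 1) := by
  intro z hz
  obtain ⟨U, g, hU, hzU, hg, hfg⟩ := hf (φ z) (hφ.2 hz)
  have hφz : DifferentiableAt ℂ φ z := hφ.1.differentiableAt (Metric.isOpen_ball.mem_nhds hz)
  have hgz : DifferentiableAt ℂ g (φ z) := hg.differentiableAt (hU.mem_nhds hzU)
  refine ((hgz.comp z hφz).congr_of_eventuallyEq ?_).differentiableWithinAt
  filter_upwards [hφz.continuousAt.preimage_mem_nhds (hU.mem_nhds hzU),
    Metric.isOpen_ball.mem_nhds hz] with w hwU hw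
  exact hfg ⟨hwU, hφ.2 hw⟩

theorem IsHolomorphicDisc.iterate_comp
    {F : EuclideanSpace ℂ (Fin d) → EuclideanSpace ℂ (Fin d)} {φ : ℂ → EuclideanSpace ℂ (Fin d)}
    (hφ : IsHolomorphicDisc M φ) (hF : HolomorphicOnSubmanifold M F) (hFM : MapsTo F M M)
    (ν : ℕ) : IsHolomorphicDisc M (F^[ν] ∘ φ) := by
  induction ν with
  | zero => exact hφ
  | succ ν ih =>
    rw [Function.iterate_succ', Function.comp_assoc]
    exact ⟨hF.differentiableOn_comp ih, hFM.comp ih.2⟩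

theorem half_add_half_mem_ball {a z : ℂ} (ha : ‖a‖ ≤ 1) (hz : z ∈ Metric.ball (0 : ℂ) 1) :
    a / 2 + z / 2 ∈ Metric.ball (0 : ℂ) 1 := by
  rw [mem_ball_zero_iff] at hz ⊢
  have h := norm_add_le (a / 2) (z / 2)
  simp only [norm_div, Complex.norm_ofNat] at h
  linarith

/-- The restriction of a holomorphic disc to the disc of radius `1 / 2` around `a / 2`. -/
theorem IsHolomorphicDisc.comp_half_add_half {φ : ℂ → EuclideanSpace ℂ (Fin d)}
    (hφ : IsHolomorphicDisc M φ) {a : ℂ} (ha : ‖a‖ ≤ 1) :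
    IsHolomorphicDisc M fun z => φ (a / 2 + z / 2) := by
  have hmaps : MapsTo (fun z : ℂ => a / 2 + z / 2) (Metric.ball 0 1) (Metric.ball 0 1) :=
    fun z hz => half_add_half_mem_ball ha hz
  exact ⟨hφ.1.comp (by fun_prop) hmaps, hφ.2.comp hmaps⟩

theorem kobayashiDist_le_poincareDist {φ : ℂ → EuclideanSpace ℂ (Fin d)}
    (hφ : IsHolomorphicDisc M φ) {a b : ℂ} (ha : a ∈ Metric.ball (0 : ℂ) 1)
    (hb : b ∈ Metric.ball (0 : ℂ) 1) :
    kobayashiDist M (φ a) (φ b) ≤ ENNReal.ofReal (poincareDist a b) := by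
  refine iInf₂_le _ ⟨1, fun i => if i = 0 then φ a else φ b, fun _ => φ, fun _ => a, fun _ => b,
    by simp, by simp, fun i hi => ?_, by simp⟩
  obtain rfl : i = 0 := by omega
  exact ⟨hφ, ha, hb, by simp, by simp⟩

theorem poincareDist_zero_left (b : ℂ) : poincareDist 0 b = Real.artanh ‖b‖ := by
  simp [poincareDist]

theorem IsHolomorphicDisc.differentiableAt_half {φ : ℂ → EuclideanSpace ℂ (Fin d)}
    (hφ : IsHolomorphicDisc M φ) {a : ℂ} (ha : ‖a‖ ≤ 1) : DifferentiableAt ℂ φ (a / 2) := by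
  refine hφ.1.differentiableAt (Metric.isOpen_ball.mem_nhds ?_)
  simpa using half_add_half_mem_ball ha (Metric.mem_ball_self (x := (0 : ℂ)) one_pos)

theorem IsHolomorphicDisc.hasDerivAt_half {φ : ℂ → EuclideanSpace ℂ (Fin d)}
    (hφ : IsHolomorphicDisc M φ) {t : ℝ} (ht : |t| ≤ 1) :
    HasDerivAt (fun s : ℝ => φ ((s : ℂ) / 2)) ((1 / 2 : ℂ) • deriv φ ((t : ℂ) / 2)) t := by
  have h : HasDerivAt (fun s : ℝ => (s : ℂ) / 2) (1 / 2) t :=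
    (Complex.ofRealCLM.hasDerivAt (x := t)).div_const 2
  exact (hφ.differentiableAt_half (by simpa using ht)).hasDerivAt.scomp t h

/-- The disc recentred at `t / 2` has the velocity of the curve as its derivative at 0, so `ξ = 1`
is a competitor. Halving the parameter is what leaves room for this disc. -/
theorem IsHolomorphicDisc.kobayashiMetric_deriv_half_le {φ : ℂ → EuclideanSpace ℂ (Fin d)}
    (hφ : IsHolomorphicDisc M φ) {t : ℝ} (ht : |t| ≤ 1) :
    kobayashiMetric M (φ ((t : ℂ) / 2)) (deriv (fun s : ℝ => φ ((s : ℂ) / 2)) t) ≤ 1 := by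
  have ht' : ‖(t : ℂ)‖ ≤ 1 := by simpa using ht
  have h : HasDerivAt (fun z : ℂ => φ ((t : ℂ) / 2 + z / 2))
      ((1 / 2 : ℂ) • deriv φ ((t : ℂ) / 2)) 0 := by
    have h2 : HasDerivAt (fun z : ℂ => (t : ℂ) / 2 + z / 2) (1 / 2) 0 :=
      ((hasDerivAt_id (0 : ℂ)).div_const 2).const_add _
    refine HasDerivAt.scomp (h := fun z : ℂ => (t : ℂ) / 2 + z / 2) 0 ?_ h2
    simpa using (hφ.differentiableAt_half ht').hasDerivAt
  refine (iInf₂_le (fun z : ℂ => φ ((t : ℂ) / 2 + z / 2)) (1 : ℂ)).trans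
    ((iInf_le _ ⟨hφ.comp_half_add_half ht', by simp, ?_⟩).trans (by simp))
  rw [h.deriv, (hφ.hasDerivAt_half ht).deriv, one_smul]

/-- Sufficiently short radial segments of holomorphic discs are almost-geodesics. -/
theorem IsHolomorphicDisc.isAlmostGeodesic {φ : ℂ → EuclideanSpace ℂ (Fin d)}
    (hφ : IsHolomorphicDisc M φ) {κ δ : ℝ} (hδ : 0 ≤ δ) (hδ1 : δ < 1) (hδκ : δ ≤ κ)
    (hκ : Real.artanh δ ≤ κ) :
    IsAlmostGeodesic M 1 κ 0 δ fun t : ℝ => φ ((t : ℂ) / 2) := by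
  have habs : ∀ t ∈ Icc 0 δ, |t| ≤ 1 := fun t ht => by
    rw [abs_of_nonneg ht.1]; exact ht.2.trans hδ1.le
  have hsub : ∀ s ∈ Icc 0 δ, ∀ t ∈ Icc 0 δ, |t - s| ≤ δ := fun s hs t ht =>
    abs_le.2 ⟨by linarith [hs.2, ht.1], by linarith [ht.2, hs.1]⟩
  refine ⟨hδ, fun t ht => ?_, fun s hs t ht => ?_, fun s hs t ht => ?_, ?_, ?_⟩
  · have := (hφ.comp_half_add_half (a := t) (by simpa using habs t ht)).2
      (Metric.mem_ball_self one_pos)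
    simpa using this
  -- The lower bound is vacuous, since `|t - s| ≤ δ ≤ κ`.
  · rw [ENNReal.ofReal_of_nonpos]
    · exact zero_le
    · linarith [hsub s hs t ht]
  · have hst : ‖(s : ℂ) - t‖ = |t - s| := by
      rw [← Complex.ofReal_sub, Complex.norm_real, Real.norm_eq_abs, abs_sub_comm]
    -- In the disc recentred at `t / 2`, the parameter `s - t` gives the point `φ (s / 2)`.
    have h := kobayashiDist_le_poincareDist
      (hφ.comp_half_add_half (a := t) (by simpa using habs t ht))
      (Metric.mem_ball_self one_pos) (b := (s : ℂ) - t)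
      (by rw [mem_ball_zero_iff, hst]; exact (hsub s hs t ht).trans_lt hδ1)
    rw [poincareDist_zero_left, hst] at h
    simp only [zero_div, add_zero, ← add_div, add_sub_cancel] at h
    refine h.trans (ENNReal.ofReal_le_ofReal ?_)
    have hmono : Real.artanh |t - s| ≤ Real.artanh δ :=
      Real.strictMonoOn_artanh.monotoneOn ⟨by linarith [abs_nonneg (t - s)],
        (hsub s hs t ht).trans_lt hδ1⟩ ⟨by linarith, hδ1⟩ (hsub s hs t ht)
    linarith [abs_nonneg (t - s)]
  · refine ContDiffOn.absolutelyContinuousOnInterval ?_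
    rw [uIcc_of_le hδ]
    refine ((hφ.1.contDiffOn Metric.isOpen_ball).restrict_scalars ℝ).comp
      (g := φ) (f := fun t : ℝ => (t : ℂ) / 2)
      (Complex.ofRealCLM.contDiff.div_const 2).contDiffOn fun t ht => ?_
    simpa using half_add_half_mem_ball (a := t) (by simpa using habs t ht)
      (Metric.mem_ball_self (x := (0 : ℂ)) one_pos)
  · refine (ae_restrict_iff' measurableSet_Icc).2 (Eventually.of_forall fun t ht => ?_)
    exact ⟨(hφ.hasDerivAt_half (habs t ht)).differentiableAt,
      by simpa using hφ.kobayashiMetric_deriv_half_le (habs t ht)⟩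

/-- For fixed `δ > 0`, every point of a submanifold near `p` is the value at `δ` of a holomorphic
disc centred at `p`. -/
theorem IsEmbeddedComplexSubmanifold.eventually_exists_disc {n : ℕ}
    (hM : IsEmbeddedComplexSubmanifold n M) {p : EuclideanSpace ℂ (Fin d)} (hp : p ∈ M)
    {δ : ℝ} (hδ : 0 < δ) :
    ∀ᶠ x in 𝓝[M] p, ∃ φ, IsHolomorphicDisc M φ ∧ φ 0 = p ∧ φ (δ : ℂ) = x := by
  obtain ⟨e, L, -, hpe, he, he', hML⟩ := hM p hp
  obtain ⟨r, hr, hball⟩ := Metric.isOpen_iff.1 e.open_target (e p) (e.map_source hpe)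
  have hev : ∀ᶠ x in 𝓝 p, x ∈ e.source ∧ e x ∈ Metric.ball (e p) (δ * r) :=
    Eventually.and (e.open_source.mem_nhds hpe)
      ((e.continuousAt hpe).preimage_mem_nhds (Metric.ball_mem_nhds _ (by positivity)))
  filter_upwards [hev.filter_mono nhdsWithin_le_nhds, self_mem_nhdsWithin] with x hx hxM
  have hδ' : (δ : ℂ) ≠ 0 := by exact_mod_cast hδ.ne'
  -- In the chart the disc is `z ↦ e p + z • u`, which reaches `e x` at `z = δ`; the radius `δ * r`
  -- above ensures `‖u‖ < r`.
  set u := (δ : ℂ)⁻¹ • (e x - e p) with hu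
  have hur : ‖u‖ < r := by
    have := hx.2
    rw [mem_ball_iff_norm] at this
    rw [hu, norm_smul, norm_inv, Complex.norm_real, Real.norm_of_nonneg hδ.le,
      inv_mul_lt_iff₀ hδ]
    exact this
  have huL : u ∈ L := L.smul_mem _ (L.sub_mem ((hML x hx.1).1 hxM) ((hML p hpe).1 hp))
  have hmaps : MapsTo (fun z : ℂ => e p + z • u) (Metric.ball 0 1) e.target := by
    intro z hz
    refine hball ?_
    rw [mem_ball_zero_iff] at hz
    rw [mem_ball_iff_norm, add_sub_cancel_left, norm_smul]
    nlinarith [norm_nonneg u, norm_nonneg z]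
  refine ⟨fun z => e.symm (e p + z • u), ⟨he'.comp (by fun_prop) hmaps, fun z hz => ?_⟩, ?_, ?_⟩
  · rw [hML _ (e.map_target (hmaps hz)), e.right_inv (hmaps hz)]
    exact L.add_mem ((hML p hpe).1 hp) (L.smul_mem _ huL)
  · simp [e.left_inv hpe]
  · simp [hu, smul_smul, mul_inv_cancel₀ hδ', e.left_inv hx.1]

theorem HasVisibility.eq_of_isHolomorphicDisc {κ : ℝ} (hvis : HasVisibility M 1 κ)
    {F ψ : EuclideanSpace ℂ (Fin d) → EuclideanSpace ℂ (Fin d)}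
    (hF : HolomorphicOnSubmanifold M F) (hFM : MapsTo F M M)
    (hψ : HolomorphicOnSubmanifold M ψ) (hψM : MapsTo ψ M (bdry M))
    (hconv : ∀ K : Set (EuclideanSpace ℂ (Fin d)), IsCompact K → K ⊆ M →
      TendstoUniformlyOn (fun ν : ℕ => F^[ν]) ψ atTop K)
    {δ : ℝ} (hδ : 0 ≤ δ) (hδ1 : δ < 1) (hδκ : δ ≤ κ) (hκ : Real.artanh δ ≤ κ)
    {φ : ℂ → EuclideanSpace ℂ (Fin d)} (hφ : IsHolomorphicDisc M φ) :
    ψ (φ 0) = ψ (φ ((δ : ℂ) / 2)) := by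
  by_contra hne
  have hmem : ∀ t ∈ Icc 0 δ, (t : ℂ) / 2 ∈ Metric.ball (0 : ℂ) 1 := fun t ht => by
    rw [mem_ball_zero_iff, norm_div, Complex.norm_real, Real.norm_of_nonneg ht.1,
      Complex.norm_ofNat]
    linarith [ht.2]
  have hmaps : MapsTo (fun t : ℝ => (t : ℂ) / 2) (Icc 0 δ) (Metric.ball 0 1) := hmem
  have hcont : ContinuousOn (fun t : ℝ => (t : ℂ) / 2) (Icc 0 δ) := by fun_prop
  have h0 : φ 0 ∈ M := hφ.2 (Metric.mem_ball_self one_pos)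
  have hδM : φ ((δ : ℂ) / 2) ∈ M := hφ.2 (hmem δ ⟨hδ, le_rfl⟩)
  obtain ⟨V, hV, W, hW, K, hK, hKM, -, hmeet⟩ := hvis.visible _ (hψM h0) _ (hψM hδM) hne
  set S := (fun t : ℝ => φ ((t : ℂ) / 2)) '' Icc 0 δ with hS
  have hSM : S ⊆ M := by
    rintro _ ⟨t, ht, rfl⟩
    exact hφ.2 (hmem t ht)
  have hScomp : IsCompact S := isCompact_Icc.image_of_continuousOn
    (hφ.1.continuousOn.comp hcont hmaps)
  have hψS : IsCompact (ψ '' S) := by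
    rw [hS, image_image]
    exact isCompact_Icc.image_of_continuousOn
      ((hψ.differentiableOn_comp hφ).continuousOn.comp hcont hmaps)
  -- The limit curve avoids `M`, hence `K`; compactness turns this into a gap `ε` that uniform
  -- convergence on `S` contradicts.
  have hdisj : Disjoint (ψ '' S) K := by
    rw [Set.disjoint_left]
    rintro _ ⟨x, hx, rfl⟩ hxK
    exact (hψM (hSM hx)).2 (hKM hxK)
  obtain ⟨ε, hε, hthick⟩ := hdisj.exists_thickenings hψS hK.isClosed
  have hlim := hconv S hScomp hSM
  have hS0 : φ 0 ∈ S := ⟨0, ⟨le_rfl, hδ⟩, by simp⟩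
  have hSδ : φ ((δ : ℂ) / 2) ∈ S := ⟨δ, ⟨hδ, le_rfl⟩, rfl⟩
  obtain ⟨ν, hν, hνV, hνW⟩ := ((Metric.tendstoUniformlyOn_iff.1 hlim ε hε).and
    (Eventually.and (hlim.tendsto_at hS0 hV) (hlim.tendsto_at hSδ hW))).exists
  obtain ⟨_, ⟨t, ht, rfl⟩, hyK⟩ := hmeet 0 δ _
    ((hφ.iterate_comp hF hFM ν).isAlmostGeodesic hδ hδ1 hδκ hκ) (by simpa using hνV) hνW
  have htS : φ ((t : ℂ) / 2) ∈ S := ⟨t, ht, rfl⟩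
  refine Set.disjoint_left.1 hthick ?_ (Metric.self_subset_thickening hε _ hyK)
  refine Metric.mem_thickening_iff.2 ⟨_, mem_image_of_mem ψ htS, ?_⟩
  rw [dist_comm]
  exact hν _ htS

theorem exists_small_artanh {κ : ℝ} (hκ : 0 < κ) :
    ∃ δ : ℝ, 0 < δ ∧ δ < 1 ∧ δ ≤ κ ∧ Real.artanh δ ≤ κ := by
  have hpos : 0 < Real.tanh κ := by
    rw [Real.tanh_eq_sinh_div_cosh]
    exact div_pos (Real.sinh_pos_iff.2 hκ) (Real.cosh_pos κ)
  refine ⟨min (Real.tanh κ) κ, lt_min hpos hκ,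
    (min_le_left _ _).trans_lt (Real.tanh_lt_one κ), min_le_right _ _, ?_⟩
  have h : (-1 : ℝ) < min (Real.tanh κ) κ := lt_min (Real.neg_one_lt_tanh κ) (by linarith)
  exact (Real.artanh_le_artanh h (Real.tanh_lt_one κ) (min_le_left _ _)).trans
    (Real.artanh_tanh κ).le

end

end KobVis

theorem mainTheorem11 {d n : ℕ} (M : Set (EuclideanSpace ℂ (Fin d)))
    (hM : KobVis.IsEmbeddedComplexSubmanifold n M)
    (hbdd : Bornology.IsBounded M) (hconn : IsConnected M)
    (κ₀ : ℝ) (hκ₀ : 0 < κ₀) (hvis : KobVis.HasVisibility M 1 κ₀)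
    (F : EuclideanSpace ℂ (Fin d) → EuclideanSpace ℂ (Fin d))
    (hF : KobVis.HolomorphicOnSubmanifold M F) (hFM : Set.MapsTo F M M)
    (ψ : EuclideanSpace ℂ (Fin d) → EuclideanSpace ℂ (Fin d))
    (hψ : KobVis.HolomorphicOnSubmanifold M ψ) (hψM : Set.MapsTo ψ M (KobVis.bdry M))
    (hconv : ∀ K : Set (EuclideanSpace ℂ (Fin d)), IsCompact K → K ⊆ M →
      TendstoUniformlyOn (fun ν : ℕ => F^[ν]) ψ Filter.atTop K) :
    ∃ ξ : EuclideanSpace ℂ (Fin d), ∀ z ∈ M, ψ z = ξ := by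
  obtain ⟨δ, hδ, hδ1, hδκ, hκ⟩ := KobVis.exists_small_artanh hκ₀
  have hloc : IsLocallyConstant fun x : M => ψ x := by
    refine (IsLocallyConstant.iff_eventually_eq _).2 fun p => ?_
    -- `δ / 2`, because the segment on `[0, δ]` runs from `φ 0` to `φ (δ / 2)`.
    have h := hM.eventually_exists_disc p.2 (half_pos hδ)
    rw [← map_nhds_subtype_val, eventually_map] at h
    filter_upwards [h] with x hx
    obtain ⟨φ, hφ, h0, hx⟩ := hx
    rw [← h0, ← hx, hvis.eq_of_isHolomorphicDisc hF hFM hψ hψM hconv hδ.le hδ1 hδκ hκ hφ]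
    push_cast
    rfl
  obtain ⟨p, hp⟩ := hconn.nonempty
  have := Subtype.preconnectedSpace hconn.isPreconnected
  exact ⟨ψ p, fun z hz => hloc.apply_eq_of_preconnectedSpace ⟨z, hz⟩ ⟨p, hp⟩⟩
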